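/- Let $\mathbb K\in\{\mathbb R,\mathbb C\}$ and let $E$ be a topological vector space over $\mathbb K$ (not assumed locally convex) which is a $k_\omega$-space, i.e. $E$ is Hausdorff and there are compact subsets $K_1\subseteq K_2\subseteq\cdots$ of $E$ with union $E$ such that a set $U\subseteq E$ is open whenever $U\cap K_n$ is relatively open in $K_n$ for every $n$. Let $T^0_\nu(E):=\mathbb K$, $T^1_\nu(E):=E$ and, for $j\ge 2$, let $T^j_\nu(E)$ be the $j$-fold tensor power $E\otimes\cdots\otimes E$, endowed with the finest vector topology making the universal $j$-linear map $E^j\to E\otimes\cdots\otimes E$, $(x_1,\dots,x_j)\mapsto x_1\otimes\cdots\otimes x_j$, continuous. Let $T_\nu(E):=\bigoplus_{j\in\mathbb N_0}T^j_\nu(E)$ be the tensor algebra of $E$, endowed with the box topology, a basis of $0$-neighbourhoods of which is formed by the sets $\bigoplus_j T^j_\nu(E)\cap\prod_j U_j$ with $U_j$ a $0$-neighbourhood in $T^j_\nu(E)$. Then $T_\nu(E)$ is a topological algebra, i.e. a topological vector space whose multiplication $T_\nu(E)\times T_\nu(E)\to T_\nu(E)$ is continuous, and it has the following universal property: for every associative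 unital topological $\mathbb K$-algebra $A$ (not assumed Hausdorff) and every continuous linear map $\phi\colon E\to A$, there is a unique continuous homomorphism $\tilde\phi\colon T_\nu(E)\to A$ of unital associative $\mathbb K$-algebras such that $\tilde\phi|_E=\phi$, where $E$ is identified with $T^1_\nu(E)\subseteq T_\nu(E)$. -/

import Mathlib

open Topology
open scoped TensorProduct DirectSum

/-- A topological space `X` is a `k_ω`-space if it is Hausdorff and is the direct limit, as a
topological space, of an ascending sequence `K 0 ⊆ K 1 ⊆ ⋯` of compact subsets with union `X`:
a set is open as soon as its trace on each `K n` is relatively open in `K n`. -/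
def IsKOmegaSpace (X : Type*) [TopologicalSpace X] : Prop :=
  T2Space X ∧ ∃ K : ℕ → Set X, Monotone K ∧ (∀ n, IsCompact (K n)) ∧ (⋃ n, K n) = Set.univ ∧
    ∀ U : Set X, (∀ n, IsOpen ((↑) ⁻¹' U : Set (K n))) → IsOpen U

section NuTopology

variable (𝕜 : Type*) [RCLike 𝕜] {ι : Type*} (E : ι → Type*) [∀ i, AddCommGroup (E i)]
  [∀ i, Module 𝕜 (E i)] [∀ i, TopologicalSpace (E i)]

/-- The vector topologies on the tensor product `⨂ i, E i` which make the universal multilinear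
map `(x i)_i ↦ ⨂ i, x i` continuous on the product `Π i, E i`. -/
def nuTopologies : Set (TopologicalSpace (⨂[𝕜] i, E i)) :=
  {t | @IsTopologicalAddGroup _ t _ ∧ @ContinuousSMul 𝕜 _ _ _ t ∧
    @Continuous _ _ _ t (fun x : ∀ i, E i => PiTensorProduct.tprod 𝕜 x)}

/-- The `ν`-topology on the tensor product `⨂ i, E i`: the finest vector topology which makes
the universal multilinear map continuous. (In the order on topologies, `t ≤ t'` means that `t` is
finer than `t'`, so that the infimum is the finest topology; it belongs to the family by
`nuTopology_mem`.) -/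
@[reducible] def nuTopology : TopologicalSpace (⨂[𝕜] i, E i) := sInf (nuTopologies 𝕜 E)

theorem nuTopology_mem : nuTopology 𝕜 E ∈ nuTopologies 𝕜 E :=
  ⟨topologicalAddGroup_sInf fun _ h => h.1, continuousSMul_sInf fun _ h => h.2.1,
    continuous_sInf_rng.2 fun _ h => h.2.2⟩

end NuTopology

section Box

variable {ι : Type*} (M : ι → Type*) [∀ i, AddCommGroup (M i)]

/-- The box topology on the direct sum `⨁ i, M i`: the boxes `(⨁ i, M i) ∩ Π i, U i` with
every `U i` open in `M i` are a basis of the open sets. -/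
@[reducible] def directSumBoxTopology (t : ∀ i, TopologicalSpace (M i)) : TopologicalSpace (⨁ i, M i) :=
  TopologicalSpace.generateFrom
    {S | ∃ U : ∀ i, Set (M i), (∀ i, IsOpen (U i)) ∧ S = {x | ∀ i, x i ∈ U i}}

/-- The boxes `(⨁ i, M i) ∩ Π i, U i`, for `U i` ranging through the `0`-neighbourhoods of `M i`,
are a basis of `0`-neighbourhoods of the direct sum. -/
theorem directSumBoxTopology_hasBasis_nhds_zero (t : ∀ i, TopologicalSpace (M i)) :
    (@nhds _ (directSumBoxTopology M t) (0 : ⨁ i, M i)).HasBasis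
      (fun U : ∀ i, Set (M i) => ∀ i, U i ∈ 𝓝 (0 : M i)) (fun U => {x | ∀ i, x i ∈ U i}) := by
  let _ := directSumBoxTopology M t
  have hb : TopologicalSpace.IsTopologicalBasis
      {S : Set (⨁ i, M i) | ∃ U : ∀ i, Set (M i), (∀ i, IsOpen (U i)) ∧
        S = {x | ∀ i, x i ∈ U i}} := by
    refine ⟨?_, ?_, rfl⟩
    · rintro _ ⟨U, hU, rfl⟩ _ ⟨V, hV, rfl⟩ x hx
      exact ⟨_, ⟨fun i => U i ∩ V i, fun i => (hU i).inter (hV i), rfl⟩,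
        fun i => ⟨hx.1 i, hx.2 i⟩, fun y hy => ⟨fun i => (hy i).1, fun i => (hy i).2⟩⟩
    · refine Set.eq_univ_of_forall fun x => ?_
      exact ⟨_, ⟨fun _ => Set.univ, fun _ => isOpen_univ, rfl⟩, fun _ => trivial⟩
  refine ⟨fun S => ?_⟩
  rw [hb.mem_nhds_iff]
  constructor
  · rintro ⟨_, ⟨U, hU, rfl⟩, h0, hS⟩
    exact ⟨U, fun i => (hU i).mem_nhds (h0 i), hS⟩
  · rintro ⟨U, hU, hS⟩
    choose V hVU hV h0 using fun i => mem_nhds_iff.1 (hU i)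
    exact ⟨_, ⟨V, hV, rfl⟩, h0, fun x hx => hS fun i => hVU i (hx i)⟩

/-- Each summand is a topological subspace of the direct sum. -/
theorem directSumBoxTopology_isEmbedding_of [DecidableEq ι] (t : ∀ i, TopologicalSpace (M i))
    (j : ι) : @IsEmbedding _ _ (t j) (directSumBoxTopology M t) (DirectSum.of M j) := by
  let _ := directSumBoxTopology M t
  refine ⟨⟨le_antisymm ?_ ?_⟩, DirectSum.of_injective j⟩
  · rw [← continuous_iff_le_induced]
    refine continuous_generateFrom_iff.2 ?_
    rintro _ ⟨U, hU, rfl⟩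
    by_cases h : ∀ i, i ≠ j → (0 : M i) ∈ U i
    · convert hU j using 1
      ext x
      constructor
      · intro hx
        simpa using hx j
      · intro hx i
        by_cases hij : i = j
        · subst hij
          simpa using hx
        · rw [DirectSum.of_eq_of_ne _ _ _ hij]
          exact h i hij
    · push Not at h
      obtain ⟨i, hij, hi⟩ := h
      convert isOpen_empty
      refine Set.eq_empty_of_forall_notMem fun x hx => hi ?_
      have := hx i
      rwa [DirectSum.of_eq_of_ne _ _ _ hij] at this
  · intro V hV
    refine ⟨{x | ∀ i, x i ∈ Function.update (fun i => (Set.univ : Set (M i))) j V i}, ?_, ?_⟩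
    · refine TopologicalSpace.isOpen_generateFrom_of_mem ⟨_, fun i => ?_, rfl⟩
      by_cases hij : i = j
      · subst hij
        simpa using hV
      · simp [Function.update_of_ne hij]
    · ext x
      constructor
      · intro hx
        simpa using hx j
      · intro hx i
        by_cases hij : i = j
        · subst hij
          simpa using hx
        · simp [Function.update_of_ne hij]

end Box

section TNu

variable (𝕜 : Type*) [RCLike 𝕜] (E : Type*) [AddCommGroup E] [Module 𝕜 E] [TopologicalSpace E]

/-- The topology of the `ν`-tensor power `T_ν^j(E) = E ⊗_ν ⋯ ⊗_ν E` (`j` factors). For `j = 0`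
and `j = 1` it is the topology of `𝕜` and of `E`, see `nuTopology_zero` and `nuTopology_one`. -/
@[reducible] def nuPowerTopology (j : ℕ) : TopologicalSpace (⨂[𝕜]^j E) := nuTopology 𝕜 fun _ : Fin j => E

/-- `T_ν^0(E)` is the field `𝕜` with its usual topology. -/
theorem nuTopology_zero : nuPowerTopology 𝕜 E 0 =
    TopologicalSpace.induced (PiTensorProduct.isEmptyEquiv (R := 𝕜) (s := fun _ => E) (Fin 0))
      (inferInstance : TopologicalSpace 𝕜) := by
  set e := PiTensorProduct.isEmptyEquiv (R := 𝕜) (s := fun _ => E) (Fin 0)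
  apply le_antisymm
  · let _ : TopologicalSpace (⨂[𝕜]^0 E) := .induced e inferInstance
    refine sInf_le ⟨topologicalAddGroup_induced e, continuousSMul_induced e, ?_⟩
    exact continuous_of_const fun x y => by rw [Subsingleton.elim x y]
  · obtain ⟨-, h, -⟩ := nuTopology_mem 𝕜 (fun _ : Fin 0 => E)
    let _ := nuPowerTopology 𝕜 E 0
    have : ContinuousSMul 𝕜 (⨂[𝕜]^0 E) := h
    have hc : Continuous fun c : 𝕜 => c • e.symm 1 := by fun_prop
    have he : (fun c : 𝕜 => c • e.symm 1) ∘ e = id := by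
      funext x
      simp [← map_smul]
    rw [continuous_iff_coinduced_le] at hc
    calc _ ≤ TopologicalSpace.induced e (TopologicalSpace.induced (fun c : 𝕜 => c • e.symm 1)
          (nuPowerTopology 𝕜 E 0)) := induced_mono (coinduced_le_iff_le_induced.1 hc)
      _ = _ := by rw [induced_compose, he, induced_id]

/-- `T_ν^1(E)` is the space `E` with its given topology. -/
theorem nuTopology_one [IsTopologicalAddGroup E] [ContinuousSMul 𝕜 E] : nuPowerTopology 𝕜 E 1 =
    TopologicalSpace.induced
      (PiTensorProduct.subsingletonEquiv (R := 𝕜) (s := fun _ => E) (0 : Fin 1))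
      (inferInstance : TopologicalSpace E) := by
  set e := PiTensorProduct.subsingletonEquiv (R := 𝕜) (s := fun _ => E) (0 : Fin 1) with he
  have hx : ∀ x : Fin 1 → E, e (PiTensorProduct.tprod 𝕜 x) = x 0 := fun x => by simp [he]
  apply le_antisymm
  · let _ : TopologicalSpace (⨂[𝕜]^1 E) := .induced e inferInstance
    refine sInf_le ⟨topologicalAddGroup_induced e, continuousSMul_induced e, ?_⟩
    refine continuous_induced_rng.2 ?_
    simpa only [Function.comp_def, hx] using continuous_apply (0 : Fin 1)
  · obtain ⟨-, -, h⟩ := nuTopology_mem 𝕜 (fun _ : Fin 1 => E)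
    let _ := nuPowerTopology 𝕜 E 1
    have hc : Continuous fun x : E => (PiTensorProduct.tprod 𝕜 fun _ : Fin 1 => x : ⨂[𝕜]^1 E) :=
      Continuous.comp h (continuous_pi fun _ => continuous_id)
    have hid : (fun x : E => (PiTensorProduct.tprod 𝕜 fun _ : Fin 1 => x : ⨂[𝕜]^1 E)) ∘ e = id := by
      funext x
      exact e.injective (hx _)
    rw [continuous_iff_coinduced_le] at hc
    calc _ ≤ TopologicalSpace.induced e (TopologicalSpace.induced _ (nuPowerTopology 𝕜 E 1)) :=
          induced_mono (coinduced_le_iff_le_induced.1 hc)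
      _ = _ := by rw [induced_compose, hid, induced_id]

/-- The tensor algebra `T_ν(E) = ⨁ j, T_ν^j(E)`, with the multiplication given by
`(x₁ ⊗ ⋯ ⊗ xᵢ) * (y₁ ⊗ ⋯ ⊗ yⱼ) = x₁ ⊗ ⋯ ⊗ xᵢ ⊗ y₁ ⊗ ⋯ ⊗ yⱼ`. -/
def TNu : Type _ := ⨁ j : ℕ, ⨂[𝕜]^j E

noncomputable instance TNu.instRing : Ring (TNu 𝕜 E) :=
  { (inferInstance : Semiring (⨁ j : ℕ, ⨂[𝕜]^j E)),
    (inferInstance : AddCommGroup (⨁ j : ℕ, ⨂[𝕜]^j E)) with }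

noncomputable instance TNu.instAlgebra : Algebra 𝕜 (TNu 𝕜 E) :=
  inferInstanceAs (Algebra 𝕜 (⨁ j : ℕ, ⨂[𝕜]^j E))

/-- `T_ν(E)` carries the box topology. -/
instance TNu.instTopologicalSpace : TopologicalSpace (TNu 𝕜 E) :=
  directSumBoxTopology (fun j : ℕ => ⨂[𝕜]^j E) (nuPowerTopology 𝕜 E)

/-- The inclusion `E = T_ν^1(E) → T_ν(E)`. -/
noncomputable def TNu.ι : E →ₗ[𝕜] TNu 𝕜 E :=
  (DirectSum.lof 𝕜 ℕ (fun j : ℕ => ⨂[𝕜]^j E) 1).comp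
    (PiTensorProduct.subsingletonEquiv (R := 𝕜) (s := fun _ => E) (0 : Fin 1)).symm.toLinearMap

/-- `E` is a topological subspace of `T_ν(E)`. -/
theorem TNu.isEmbedding_ι [IsTopologicalAddGroup E] [ContinuousSMul 𝕜 E] :
    IsEmbedding (TNu.ι 𝕜 E) := by
  let _ := nuPowerTopology 𝕜 E 1
  set e := PiTensorProduct.subsingletonEquiv (R := 𝕜) (s := fun _ => E) (0 : Fin 1)
  have hs : IsEmbedding (e.symm : E → ⨂[𝕜]^1 E) := by
    refine ⟨⟨?_⟩, e.symm.injective⟩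
    change _ = TopologicalSpace.induced e.symm (nuPowerTopology 𝕜 E 1)
    rw [nuTopology_one 𝕜 E, induced_compose]
    have : e ∘ e.symm = id := funext e.apply_symm_apply
    rw [this, induced_id]
  let _ := directSumBoxTopology (fun j : ℕ => ⨂[𝕜]^j E) (nuPowerTopology 𝕜 E)
  exact (directSumBoxTopology_isEmbedding_of (fun j : ℕ => ⨂[𝕜]^j E)
    (nuPowerTopology 𝕜 E) 1).comp hs

end TNu

/-! Continuity of a multiplication on a direct sum is delicate because a bilinear map that is
continuous on all pairs of summands need not be continuous. The remedy is to present `T_ν(E)` as a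
quotient of a space on which bilinear maps are easy to control. Let `X` be the disjoint union of the
powers `E^j`, the space of words; it is again `k_ω`. The free vector space `F` on `X` is a quotient
of the `k_ω`-space of finite sequences of weighted words. Products of quotient maps from
`k_ω`-spaces onto Hausdorff spaces are quotient maps
(`Topology.IsQuotientMap.prodMap_of_isKOmegaSpace`), so `F` is a topological vector space, and a
bilinear map on `F × F` is continuous once it is so on `X × X` (`FreeTVS.continuous_bilinear`). The
linear map `F → T_ν(E)` evaluating words is open (`TNu.isOpenQuotientMap_lift_word`), because
`T_ν(E)` and `F` modulo the kernel have the same universal property. Openness passes to the square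
of this map, so multiplication is continuous as soon as concatenation `X × X → X` is. The universal
property combines that of the algebraic tensor algebra with the fact that a linear map on `T_ν(E)`
is continuous if it is continuous on words. -/

/-! ### Products and quotients of `k_ω`-spaces -/

/-- An ascending sequence of compact sets covering `X` which determines the topology of `X`. -/
structure IsKOmegaExhaustion {X : Type*} [TopologicalSpace X] (K : ℕ → Set X) : Prop where
  mono : Monotone K
  isCompact : ∀ n, IsCompact (K n)
  exists_mem : ∀ x, ∃ n, x ∈ K n
  isOpen : ∀ U : Set X, (∀ n, ∀ x ∈ K n, x ∈ U → U ∈ 𝓝[K n] x) → IsOpen U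

theorem isKOmegaSpace_iff {X : Type*} [TopologicalSpace X] :
    IsKOmegaSpace X ↔ T2Space X ∧ ∃ K : ℕ → Set X, IsKOmegaExhaustion K := by
  have key : ∀ (U K : Set X), IsOpen ((↑) ⁻¹' U : Set K) ↔ ∀ x ∈ K, x ∈ U → U ∈ 𝓝[K] x := by
    intro U K
    simp only [isOpen_iff_mem_nhds, Subtype.forall, Set.mem_preimage,
      preimage_coe_mem_nhds_subtype]
  refine and_congr_right fun _ => exists_congr fun K => ⟨?_, ?_⟩
  · rintro ⟨h1, h2, h3, h4⟩
    refine ⟨h1, h2, fun x => Set.mem_iUnion.1 (h3 ▸ Set.mem_univ x), fun U hU => h4 U fun n => ?_⟩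
    exact (key U (K n)).2 (hU n)
  · rintro ⟨h1, h2, h3, h4⟩
    refine ⟨h1, h2, Set.eq_univ_of_forall fun x => Set.mem_iUnion.2 (h3 x), fun U hU =>
      h4 U fun n => (key U (K n)).1 (hU n)⟩

/-- Disjoint open sets separate `A` from the compact set `K \ u`; removing from `K` the one around
`K \ u` leaves `B`. -/
theorem IsCompact.exists_isCompact_forall_mem_nhdsWithin {X : Type*} [TopologicalSpace X]
    [T2Space X] {K A u : Set X} (hK : IsCompact K) (hA : IsCompact A) (hu : IsOpen u)
    (hAu : A ⊆ u) :
    ∃ B, IsCompact B ∧ B ⊆ K ∧ B ⊆ u ∧ ∀ a ∈ A, B ∈ 𝓝[K] a := by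
  obtain ⟨O, O', hO, hO', hAO, hKO, hd⟩ := SeparatedNhds.of_isCompact_isCompact hA
    (hK.diff hu) (Set.disjoint_left.2 fun x hx hx' => hx'.2 (hAu hx))
  refine ⟨K \ O', hK.diff hO', Set.sdiff_subset, fun x hx => ?_, fun a ha => ?_⟩
  · by_contra hxu
    exact hx.2 (hKO ⟨hx.1, hxu⟩)
  · filter_upwards [self_mem_nhdsWithin, mem_nhdsWithin_of_mem_nhds (hO.mem_nhds (hAO ha))]
      with x hx hxO
    exact ⟨hx, Set.disjoint_left.1 hd hxO⟩

namespace IsKOmegaExhaustion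

variable {X Y : Type*} [TopologicalSpace X] [TopologicalSpace Y] {K : ℕ → Set X} {L : ℕ → Set Y}

theorem isKOmegaSpace [T2Space X] (hK : IsKOmegaExhaustion K) : IsKOmegaSpace X :=
  isKOmegaSpace_iff.2 ⟨inferInstance, K, hK⟩

/-- A union of subsets `A n ⊆ K (N + n)`, each a relative neighbourhood of the preceding one,
is open. -/
theorem isOpen_iUnion (hK : IsKOmegaExhaustion K) {A : ℕ → Set X} {N : ℕ}
    (hA : ∀ n, A n ⊆ K (N + n)) (hn : ∀ n, ∀ a ∈ A n, A (n + 1) ∈ 𝓝[K (N + (n + 1))] a) :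
    IsOpen (⋃ n, A n) := by
  have hm : Monotone A := monotone_nat_of_le_succ fun n a ha =>
    mem_of_mem_nhdsWithin (hK.mono (by omega) (hA n ha)) (hn n a ha)
  refine hK.isOpen _ fun m x _ hx => ?_
  obtain ⟨n, hxn⟩ := Set.mem_iUnion.1 hx
  have h := hn (n + m) x (hm (by omega) hxn)
  exact Filter.mem_of_superset (nhdsWithin_mono x (hK.mono (by omega)) h)
    (Set.subset_iUnion A _)

/-- Around a point of `S` one grows compact boxes inside `S`, the box at stage `k + 1` being a
relative neighbourhood of the box at stage `k`. By `isOpen_iUnion` the unions of the two sides are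
open, and as the boxes increase, the product of these unions stays in `S`. -/
theorem prod [T2Space X] [T2Space Y] (hK : IsKOmegaExhaustion K) (hL : IsKOmegaExhaustion L) :
    IsKOmegaExhaustion fun n => K n ×ˢ L n := by
  refine ⟨fun m n h => Set.prod_mono (hK.mono h) (hL.mono h),
    fun n => (hK.isCompact n).prod (hL.isCompact n), ?_, ?_⟩
  · rintro ⟨x, y⟩
    obtain ⟨m, hm⟩ := hK.exists_mem x
    obtain ⟨n, hn⟩ := hL.exists_mem y
    exact ⟨max m n, hK.mono (le_max_left _ _) hm, hL.mono (le_max_right _ _) hn⟩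
  intro S hS
  refine isOpen_iff_mem_nhds.2 ?_
  rintro ⟨x, y⟩ hxy
  obtain ⟨m, hm⟩ := hK.exists_mem x
  obtain ⟨n, hn⟩ := hL.exists_mem y
  set N := max m n
  let P : ℕ → Type _ := fun k => {p : Set X × Set Y // IsCompact p.1 ∧ IsCompact p.2 ∧
    p.1 ⊆ K (N + k) ∧ p.2 ⊆ L (N + k) ∧ p.1 ×ˢ p.2 ⊆ S}
  have step : ∀ k (p : P k), ∃ q : P (k + 1), (∀ a ∈ p.1.1, q.1.1 ∈ 𝓝[K (N + (k + 1))] a) ∧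
      ∀ b ∈ p.1.2, q.1.2 ∈ 𝓝[L (N + (k + 1))] b := by
    rintro k ⟨⟨A, B⟩, hA, hB, hAK, hBL, hAB⟩
    dsimp only at *
    have hle : N + k ≤ N + (k + 1) := by omega
    -- Only the trace of `S` on the next compact box is known to be open, so the tube lemma is
    -- applied to the interior of the union of `S` with the complement of that box.
    obtain ⟨u, v, hu, hv, hAu, hBv, huv⟩ := generalized_tube_lemma hA hB
      (n := interior {p | p ∈ K (N + (k + 1)) ×ˢ L (N + (k + 1)) → p ∈ S}) isOpen_interior
      (fun p hp => mem_interior_iff_mem_nhds.2 (Filter.mem_inf_principal.1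
        (hS _ p ⟨hK.mono hle (hAK hp.1), hL.mono hle (hBL hp.2)⟩ (hAB hp))))
    obtain ⟨A', hA', hAK', hAu', hAn⟩ :=
      (hK.isCompact (N + (k + 1))).exists_isCompact_forall_mem_nhdsWithin hA hu hAu
    obtain ⟨B', hB', hBL', hBv', hBn⟩ :=
      (hL.isCompact (N + (k + 1))).exists_isCompact_forall_mem_nhdsWithin hB hv hBv
    exact ⟨⟨⟨A', B'⟩, hA', hB', hAK', hBL', fun p hp =>
      interior_subset (huv ⟨hAu' hp.1, hBv' hp.2⟩) ⟨hAK' hp.1, hBL' hp.2⟩⟩, hAn, hBn⟩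
  choose f hfA hfB using step
  let p₀ : P 0 := ⟨⟨{x}, {y}⟩, isCompact_singleton, isCompact_singleton,
    Set.singleton_subset_iff.2 (hK.mono (le_max_left _ _) hm),
    Set.singleton_subset_iff.2 (hL.mono (le_max_right _ _) hn), by
      rw [Set.singleton_prod_singleton]; exact Set.singleton_subset_iff.2 hxy⟩
  let p : ∀ k, P k := fun k => Nat.rec p₀ f k
  have hA := hK.isOpen_iUnion (A := fun k => (p k).1.1) (fun k => (p k).2.2.2.1)
    (fun k => hfA k (p k))
  have hB := hL.isOpen_iUnion (A := fun k => (p k).1.2) (fun k => (p k).2.2.2.2.1)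
    (fun k => hfB k (p k))
  have hmA : Monotone fun k => (p k).1.1 := monotone_nat_of_le_succ fun k a ha =>
    mem_of_mem_nhdsWithin (hK.mono (by omega) ((p k).2.2.2.1 ha)) (hfA k (p k) a ha)
  have hmB : Monotone fun k => (p k).1.2 := monotone_nat_of_le_succ fun k a ha =>
    mem_of_mem_nhdsWithin (hL.mono (by omega) ((p k).2.2.2.2.1 ha)) (hfB k (p k) a ha)
  refine Filter.mem_of_superset (prod_mem_nhds
    (hA.mem_nhds (Set.mem_iUnion.2 ⟨0, Set.mem_singleton x⟩))
    (hB.mem_nhds (Set.mem_iUnion.2 ⟨0, Set.mem_singleton y⟩))) ?_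
  rintro ⟨a, b⟩ ⟨ha, hb⟩
  obtain ⟨i, hi⟩ := Set.mem_iUnion.1 ha
  obtain ⟨j, hj⟩ := Set.mem_iUnion.1 hb
  exact (p (max i j)).2.2.2.2.2 ⟨hmA (le_max_left _ _) hi, hmB (le_max_right _ _) hj⟩

theorem image_homeomorph (hK : IsKOmegaExhaustion K) (e : X ≃ₜ Y) :
    IsKOmegaExhaustion fun n => e '' K n := by
  refine ⟨fun m n h => Set.image_mono (hK.mono h), fun n => (hK.isCompact n).image e.continuous,
    fun y => ?_, fun U hU => ?_⟩
  · obtain ⟨n, hn⟩ := hK.exists_mem (e.symm y)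
    exact ⟨n, _, hn, e.apply_symm_apply y⟩
  · refine e.isOpen_preimage.1 (hK.isOpen _ fun n x hx hxU => ?_)
    have h := hU n (e x) ⟨x, hx, rfl⟩ hxU
    exact e.continuous.continuousWithinAt.tendsto_nhdsWithin (Set.mapsTo_image e (K n)) h

theorem closedBall (M : Type*) [SeminormedAddCommGroup M] [ProperSpace M] :
    IsKOmegaExhaustion fun n : ℕ => Metric.closedBall (0 : M) n := by
  refine ⟨fun m n h => Metric.closedBall_subset_closedBall (by exact_mod_cast h),
    fun n => isCompact_closedBall _ _, fun x => ?_, fun U hU => ?_⟩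
  · obtain ⟨n, hn⟩ := exists_nat_ge ‖x‖
    exact ⟨n, by simpa using hn⟩
  · refine isOpen_iff_mem_nhds.2 fun x hx => ?_
    obtain ⟨n, hn⟩ := exists_nat_gt ‖x‖
    have h := hU n x (by simpa using hn.le) hx
    rwa [nhdsWithin_eq_nhds.2 (Metric.closedBall_mem_nhds_of_mem (by simpa using hn))] at h

theorem sigma {X : ℕ → Type*} [∀ i, TopologicalSpace (X i)] {K : ∀ i, ℕ → Set (X i)}
    (hK : ∀ i, IsKOmegaExhaustion (K i)) :
    IsKOmegaExhaustion fun n => ⋃ i ∈ Set.Iic n, Sigma.mk i '' K i n := by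
  refine ⟨fun m n h => ?_, fun n => ?_, ?_, fun U hU => ?_⟩
  · exact Set.biUnion_mono (Set.Iic_subset_Iic.2 h) fun i _ => Set.image_mono ((hK i).mono h)
  · exact (Set.finite_Iic n).isCompact_biUnion fun i _ =>
      ((hK i).isCompact n).image continuous_sigmaMk
  · rintro ⟨i, x⟩
    obtain ⟨n, hn⟩ := (hK i).exists_mem x
    exact ⟨max i n, Set.mem_biUnion (Set.mem_Iic.2 (le_max_left i n))
      ⟨x, (hK i).mono (le_max_right _ _) hn, rfl⟩⟩
  · refine isOpen_sigma_iff.2 fun i => (hK i).isOpen _ fun n x hx hxU => ?_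
    have hsub : Sigma.mk i '' K i n ⊆ ⋃ j ∈ Set.Iic (max i n), Sigma.mk j '' K j (max i n) :=
      (Set.image_mono ((hK i).mono (le_max_right _ _))).trans
        (Set.subset_biUnion_of_mem (u := fun j => Sigma.mk j '' K j (max i n))
          (Set.mem_Iic.2 (le_max_left i n)))
    have h := hU (max i n) ⟨i, x⟩ (hsub ⟨x, hx, rfl⟩) hxU
    exact continuous_sigmaMk.continuousWithinAt.tendsto_nhdsWithin
      (fun z hz => hsub ⟨z, hz, rfl⟩) h

end IsKOmegaExhaustion

theorem IsKOmegaSpace.finPi {X : Type*} [TopologicalSpace X] (hX : IsKOmegaSpace X) (n : ℕ) :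
    IsKOmegaSpace (Fin n → X) := by
  obtain ⟨_, K, hK⟩ := isKOmegaSpace_iff.1 hX
  induction n with
  | zero =>
    refine isKOmegaSpace_iff.2 ⟨inferInstance, fun _ => Set.univ, fun _ _ _ => le_rfl,
      fun _ => isCompact_univ, fun x => ⟨0, trivial⟩, fun U _ => ?_⟩
    exact isOpen_discrete U
  | succ n ih =>
    obtain ⟨_, L, hL⟩ := isKOmegaSpace_iff.1 ih
    exact ((hL.prod (hK.image_homeomorph (Homeomorph.funUnique (Fin 1) X).symm)).image_homeomorph
      (Fin.appendHomeomorph n 1)).isKOmegaSpace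

theorem IsKOmegaSpace.sigma {X : ℕ → Type*} [∀ i, TopologicalSpace (X i)]
    (hX : ∀ i, IsKOmegaSpace (X i)) : IsKOmegaSpace (Σ i, X i) := by
  have h := fun i => isKOmegaSpace_iff.1 (hX i)
  have := fun i => (h i).1
  choose K hK using fun i => (h i).2
  exact (IsKOmegaExhaustion.sigma hK).isKOmegaSpace

theorem IsKOmegaSpace.prod {X Y : Type*} [TopologicalSpace X] [TopologicalSpace Y]
    (hX : IsKOmegaSpace X) (hY : IsKOmegaSpace Y) : IsKOmegaSpace (X × Y) := by
  obtain ⟨_, K, hK⟩ := isKOmegaSpace_iff.1 hX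
  obtain ⟨_, L, hL⟩ := isKOmegaSpace_iff.1 hY
  exact (hK.prod hL).isKOmegaSpace

/-- The image of the compact set `K \ f ⁻¹' S` is closed and misses `y`; its complement meets `f ''
K` only inside `S`. -/
theorem IsCompact.mem_nhdsWithin_image {X Y : Type*} [TopologicalSpace X] [TopologicalSpace Y]
    [T2Space Y] {K : Set X} (hK : IsCompact K) {f : X → Y} (hf : Continuous f) {S : Set Y}
    (hS : IsOpen (f ⁻¹' S)) {y : Y} (hy : y ∈ S) : S ∈ 𝓝[f '' K] y := by
  have hc : IsClosed (f '' (K \ f ⁻¹' S)) := ((hK.diff hS).image hf).isClosed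
  have hyc : y ∉ f '' (K \ f ⁻¹' S) := by
    rintro ⟨x, hx, rfl⟩
    exact hx.2 hy
  filter_upwards [self_mem_nhdsWithin, mem_nhdsWithin_of_mem_nhds (hc.isOpen_compl.mem_nhds hyc)]
  rintro _ ⟨x, hx, rfl⟩ hxc
  by_contra hxS
  exact hxc ⟨x, ⟨hx, hxS⟩, rfl⟩

theorem IsKOmegaExhaustion.image {X Y : Type*} [TopologicalSpace X] [TopologicalSpace Y]
    {K : ℕ → Set X} (hK : IsKOmegaExhaustion K) {f : X → Y} (hf : IsQuotientMap f) :
    IsKOmegaExhaustion fun n => f '' K n := by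
  refine ⟨fun m n h => Set.image_mono (hK.mono h), fun n => (hK.isCompact n).image hf.continuous,
    fun y => ?_, fun U hU => hf.isOpen_preimage.1 (hK.isOpen _ fun n x hx hxU => ?_)⟩
  · obtain ⟨x, rfl⟩ := hf.surjective y
    obtain ⟨n, hn⟩ := hK.exists_mem x
    exact ⟨n, x, hn, rfl⟩
  · exact hf.continuous.continuousWithinAt.tendsto_nhdsWithin (Set.mapsTo_image f (K n))
      (hU n (f x) ⟨x, hx, rfl⟩ hxU)

/-- A product of quotient maps from `k_ω`-spaces onto Hausdorff spaces is a quotient map. -/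
theorem Topology.IsQuotientMap.prodMap_of_isKOmegaSpace {X X' Y Y' : Type*} [TopologicalSpace X]
    [TopologicalSpace X'] [TopologicalSpace Y] [TopologicalSpace Y'] [T2Space Y] [T2Space Y']
    (hX : IsKOmegaSpace X) (hX' : IsKOmegaSpace X') {f : X → Y} {g : X' → Y'}
    (hf : IsQuotientMap f) (hg : IsQuotientMap g) : IsQuotientMap (Prod.map f g) := by
  obtain ⟨_, K, hK⟩ := isKOmegaSpace_iff.1 hX
  obtain ⟨_, L, hL⟩ := isKOmegaSpace_iff.1 hX'
  have hc : Continuous (Prod.map f g) := hf.continuous.prodMap hg.continuous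
  refine ⟨isCoinducing_iff.2 fun S => ⟨fun hS =>
    ((hK.image hf).prod (hL.image hg)).isOpen S fun n y _ hyS => ?_, fun hS => hS.preimage hc⟩,
    hf.surjective.prodMap hg.surjective⟩
  rw [← Set.prodMap_image_prod]
  exact ((hK.isCompact n).prod (hL.isCompact n)).mem_nhdsWithin_image hc hS hyS

/-! ### Complete regularity, and continuity on disjoint unions -/

instance Sigma.instCompletelyRegularSpace {ι : Type*} {X : ι → Type*}
    [∀ i, TopologicalSpace (X i)] [∀ i, CompletelyRegularSpace (X i)] :
    CompletelyRegularSpace (Σ i, X i) := by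
  classical
  refine ⟨?_⟩
  rintro ⟨i, a⟩ K hK ha
  obtain ⟨f, hf, hfa, hfK⟩ := CompletelyRegularSpace.completely_regular a (Sigma.mk i ⁻¹' K)
    (hK.preimage continuous_sigmaMk) ha
  refine ⟨fun p => if h : p.1 = i then f (h ▸ p.2) else 1, ?_, by simpa using hfa, ?_⟩
  · refine continuous_sigma fun j => ?_
    by_cases h : j = i
    · subst h
      simpa using hf
    · simpa [h] using continuous_const
  · rintro ⟨j, x⟩ hx
    by_cases h : j = i
    · subst h
      simpa using hfK hx
    · simp [h]

theorem IsTopologicalAddGroup.completelyRegularSpace (G : Type*) [AddGroup G]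
    [TopologicalSpace G] [IsTopologicalAddGroup G] : CompletelyRegularSpace G :=
  let _ := IsTopologicalAddGroup.rightUniformSpace G
  inferInstance

theorem continuous_prod_sigma {κ A Z : Type*} {B : κ → Type*} [TopologicalSpace A]
    [∀ k, TopologicalSpace (B k)] [TopologicalSpace Z] {f : A × (Σ k, B k) → Z}
    (hf : ∀ k, Continuous fun p : A × B k => f (p.1, ⟨k, p.2⟩)) : Continuous f := by
  refine continuous_iff_continuousAt.2 ?_
  rintro ⟨a, ⟨k, b⟩⟩
  rw [ContinuousAt, nhds_prod_eq, Sigma.nhds_mk, Filter.prod_map_right, Filter.tendsto_map'_iff,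
    ← nhds_prod_eq]
  exact (hf k).continuousAt

theorem continuous_sigma_prod {ι κ Z : Type*} {A : ι → Type*} {B : κ → Type*}
    [∀ i, TopologicalSpace (A i)] [∀ k, TopologicalSpace (B k)] [TopologicalSpace Z]
    {f : (Σ i, A i) × (Σ k, B k) → Z}
    (hf : ∀ i k, Continuous fun p : A i × B k => f (⟨i, p.1⟩, ⟨k, p.2⟩)) : Continuous f :=
  continuous_prod_sigma fun k => (continuous_prod_sigma (f := fun p : B k × Σ i, A i =>
    f (p.2, ⟨k, p.1⟩)) fun i => (hf i k).comp continuous_swap).comp continuous_swap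

/-! ### The free topological vector space on a `k_ω`-space -/

section FreeTVS

variable (𝕜 : Type*) [RCLike 𝕜] (X : Type*)

/-- The free vector space on a topological space `X`, with the final topology with respect to the
maps `(𝕜 × X)^n → FreeTVS 𝕜 X`, `(cᵢ, xᵢ)ᵢ ↦ ∑ i, cᵢ xᵢ`. -/
def FreeTVS : Type _ := X →₀ 𝕜

namespace FreeTVS

noncomputable instance : AddCommGroup (FreeTVS 𝕜 X) := inferInstanceAs (AddCommGroup (X →₀ 𝕜))

noncomputable instance : Module 𝕜 (FreeTVS 𝕜 X) := inferInstanceAs (Module 𝕜 (X →₀ 𝕜))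

variable {X} in
/-- The inclusion of the basis. -/
noncomputable def of (x : X) : FreeTVS 𝕜 X := Finsupp.single x 1

variable {X} in
/-- The linear combination `∑ i, cᵢ xᵢ` of a finite sequence of pairs `(cᵢ, xᵢ)`. -/
noncomputable def comb (p : Σ n : ℕ, Fin n → 𝕜 × X) : FreeTVS 𝕜 X :=
  ∑ i, (p.2 i).1 • of 𝕜 (p.2 i).2

noncomputable instance [TopologicalSpace X] : TopologicalSpace (FreeTVS 𝕜 X) :=
  .coinduced (comb 𝕜) inferInstance

variable {X}

/-- The linear extension of a map from `X` to a vector space. -/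
noncomputable def lift {W : Type*} [AddCommMonoid W] [Module 𝕜 W] (f : X → W) :
    FreeTVS 𝕜 X →ₗ[𝕜] W := Finsupp.linearCombination 𝕜 f

@[simp]
theorem lift_of {W : Type*} [AddCommMonoid W] [Module 𝕜 W] (f : X → W) (x : X) :
    lift 𝕜 f (of 𝕜 x) = f x :=
  (Finsupp.linearCombination_single 𝕜 1 x).trans (one_smul 𝕜 _)

theorem comb_append {m n : ℕ} (p : Fin m → 𝕜 × X) (q : Fin n → 𝕜 × X) :
    comb 𝕜 ⟨m + n, Fin.append p q⟩ = comb 𝕜 ⟨m, p⟩ + comb 𝕜 ⟨n, q⟩ := by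
  simp [comb, Fin.sum_univ_add]

theorem comb_surjective : Function.Surjective (comb 𝕜 (X := X)) := by
  intro v
  induction v using Finsupp.induction_linear with
  | zero => exact ⟨⟨0, Fin.elim0⟩, by simp [comb]; rfl⟩
  | add f g hf hg =>
    obtain ⟨⟨m, p⟩, rfl⟩ := hf
    obtain ⟨⟨n, q⟩, rfl⟩ := hg
    exact ⟨_, comb_append 𝕜 p q⟩
  | single x c => exact ⟨⟨1, fun _ => (c, x)⟩,
    (Fin.sum_univ_one _).trans (Finsupp.smul_single_one x c)⟩

variable [TopologicalSpace X]

theorem isQuotientMap_comb : IsQuotientMap (comb 𝕜 (X := X)) := ⟨⟨rfl⟩, comb_surjective 𝕜⟩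

theorem continuous_of : Continuous (of 𝕜 (X := X)) := by
  have h : of 𝕜 (X := X) = comb 𝕜 ∘ Sigma.mk 1 ∘ fun x _ => (1, x) := by
    funext x
    simp [comb]
  rw [h]
  exact (isQuotientMap_comb 𝕜).continuous.comp (continuous_sigmaMk.comp (by fun_prop))

theorem continuous_linearMap {W : Type*} [AddCommMonoid W] [Module 𝕜 W] [TopologicalSpace W]
    [ContinuousAdd W] [ContinuousSMul 𝕜 W] (f : FreeTVS 𝕜 X →ₗ[𝕜] W)
    (hf : Continuous fun x => f (of 𝕜 x)) : Continuous f := by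
  refine (isQuotientMap_comb 𝕜).continuous_iff.2 (continuous_sigma fun n => ?_)
  change Continuous fun p : Fin n → 𝕜 × X => f (∑ i, (p i).1 • of 𝕜 (p i).2)
  simp only [map_sum, map_smul]
  refine continuous_finsetSum _ fun i _ => ?_
  refine Continuous.smul (by fun_prop) ?_
  exact hf.comp (f := fun p : Fin n → 𝕜 × X => (p i).2) (by fun_prop)

/-- A continuous function equal to `1` at one point of the support of `w` and to `0` at the others
picks out a single nonzero coefficient. -/
theorem exists_linearCombination_ne_zero [CompletelyRegularSpace X] [T2Space X] {w : X →₀ 𝕜}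
    (hw : w ≠ 0) : ∃ f : C(X, 𝕜), Finsupp.linearCombination 𝕜 f w ≠ 0 := by
  classical
  obtain ⟨x, hx⟩ := Finsupp.ne_iff.1 hw
  obtain ⟨f, hf, hfx, hfK⟩ := CompletelyRegularSpace.completely_regular x
    (↑(w.support.erase x)) (Finset.finite_toSet _).isClosed (by simp)
  refine ⟨⟨fun y => ((1 - (f y : ℝ) : ℝ) : 𝕜), by fun_prop⟩, ?_⟩
  rw [Finsupp.linearCombination_apply, Finsupp.sum, Finset.sum_eq_single x]
  · simpa [hfx] using hx
  · intro y hy hyx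
    have : f y = 1 := hfK (Finset.mem_coe.2 (Finset.mem_erase.2 ⟨hyx, hy⟩))
    simp [this]
  · intro h
    simp [Finsupp.notMem_support_iff.1 h]

/-- Continuous functions on `X` extend to continuous linear functionals, which separate points. The
Hausdorff property is what permits multiplying the quotient map `comb` with itself. -/
instance [CompletelyRegularSpace X] [T2Space X] : T2Space (FreeTVS 𝕜 X) := by
  refine T2Space.of_injective_continuous (f := fun v (f : C(X, 𝕜)) => lift 𝕜 f v) ?_ ?_
  · intro u v huv
    by_contra hne
    obtain ⟨f, hf⟩ := exists_linearCombination_ne_zero 𝕜 (w := u - v) (sub_ne_zero.2 hne)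
    exact hf ((map_sub (lift 𝕜 f) u v).trans (sub_eq_zero.2 (congrFun huv f)))
  · exact continuous_pi fun f => continuous_linearMap 𝕜 _ (by simpa using f.continuous)

/-- The parametrization of the free vector space by finite sequences has a `k_ω`-space as its
domain. -/
theorem isKOmegaSpace_sigma (hX : IsKOmegaSpace X) : IsKOmegaSpace (Σ n : ℕ, Fin n → 𝕜 × X) :=
  .sigma fun n => .finPi ((IsKOmegaExhaustion.closedBall 𝕜).isKOmegaSpace.prod hX) n

theorem isQuotientMap_prodMap_comb [CompletelyRegularSpace X] (hX : IsKOmegaSpace X) {Y : Type*}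
    [TopologicalSpace Y] [CompletelyRegularSpace Y] (hY : IsKOmegaSpace Y) :
    IsQuotientMap (Prod.map (comb 𝕜 (X := X)) (comb 𝕜 (X := Y))) :=
  have := hX.1
  have := hY.1
  (isQuotientMap_comb 𝕜).prodMap_of_isKOmegaSpace (isKOmegaSpace_sigma 𝕜 hX)
    (isKOmegaSpace_sigma 𝕜 hY) (isQuotientMap_comb 𝕜)

theorem continuousSMul [CompletelyRegularSpace X] (hX : IsKOmegaSpace X) :
    ContinuousSMul 𝕜 (FreeTVS 𝕜 X) := by
  have := hX.1
  have hq := (IsQuotientMap.id (X := 𝕜)).prodMap_of_isKOmegaSpace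
    (IsKOmegaExhaustion.closedBall 𝕜).isKOmegaSpace (isKOmegaSpace_sigma 𝕜 hX)
    (isQuotientMap_comb 𝕜 (X := X))
  refine ⟨hq.continuous_iff.2 ?_⟩
  have h : Continuous fun p : 𝕜 × Σ n : ℕ, Fin n → 𝕜 × X =>
      comb 𝕜 ⟨p.2.1, fun i => (p.1 * (p.2.2 i).1, (p.2.2 i).2)⟩ := by
    refine (isQuotientMap_comb 𝕜).continuous.comp (continuous_prod_sigma fun n => ?_)
    exact (continuous_sigmaMk (σ := fun n : ℕ => Fin n → 𝕜 × X)).comp (f := fun p : 𝕜 × (Fin n → 𝕜 × X) =>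
      fun i => (p.1 * (p.2 i).1, (p.2 i).2)) (by fun_prop)
  convert h using 1
  funext p
  simp [comb, Finset.smul_sum, mul_smul]

theorem continuousAdd [CompletelyRegularSpace X] (hX : IsKOmegaSpace X) :
    ContinuousAdd (FreeTVS 𝕜 X) := by
  refine ⟨(isQuotientMap_prodMap_comb 𝕜 hX hX).continuous_iff.2
    (continuous_sigma_prod fun m n => ?_)⟩
  simp only [Function.comp_def, Prod.map_apply, ← comb_append]
  exact (isQuotientMap_comb 𝕜).continuous.comp
    (continuous_sigmaMk.comp (Fin.appendHomeomorph m n).continuous)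

theorem isTopologicalAddGroup [CompletelyRegularSpace X] (hX : IsKOmegaSpace X) :
    IsTopologicalAddGroup (FreeTVS 𝕜 X) :=
  have := continuousAdd 𝕜 hX
  have := continuousSMul 𝕜 hX
  { continuous_neg := by simpa using continuous_const_smul (T := FreeTVS 𝕜 X) (-1 : 𝕜) }

/-- A bilinear map on a product of free vector spaces is continuous if it is continuous on the
product of the bases. -/
theorem continuous_bilinear [CompletelyRegularSpace X] (hX : IsKOmegaSpace X) {Y : Type*}
    [TopologicalSpace Y] [CompletelyRegularSpace Y] (hY : IsKOmegaSpace Y)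
    {W : Type*} [AddCommMonoid W] [Module 𝕜 W] [TopologicalSpace W]
    [ContinuousAdd W] [ContinuousSMul 𝕜 W] (b : FreeTVS 𝕜 X →ₗ[𝕜] FreeTVS 𝕜 Y →ₗ[𝕜] W)
    (hb : Continuous fun p : X × Y => b (of 𝕜 p.1) (of 𝕜 p.2)) :
    Continuous fun p : FreeTVS 𝕜 X × FreeTVS 𝕜 Y => b p.1 p.2 := by
  refine (isQuotientMap_prodMap_comb 𝕜 hX hY).continuous_iff.2
    (continuous_sigma_prod fun m n => ?_)
  change Continuous fun p : (Fin m → 𝕜 × X) × (Fin n → 𝕜 × Y) =>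
    b (∑ i, (p.1 i).1 • of 𝕜 (p.1 i).2) (∑ j, (p.2 j).1 • of 𝕜 (p.2 j).2)
  simp only [map_sum, map_smul, LinearMap.sum_apply, LinearMap.smul_apply]
  refine continuous_finsetSum _ fun i _ => ?_
  refine Continuous.smul (by fun_prop) (continuous_finsetSum _ fun j _ => ?_)
  refine Continuous.smul (by fun_prop) ?_
  exact hb.comp (f := fun p : (Fin m → 𝕜 × X) × (Fin n → 𝕜 × Y) => ((p.1 j).2, (p.2 i).2))
    (by fun_prop)

end FreeTVS
end FreeTVS

/-! ### Box topologies on direct sums -/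

section Box

variable {ι : Type*} {M : ι → Type*} [∀ i, AddCommGroup (M i)] [t : ∀ i, TopologicalSpace (M i)]

theorem isOpen_directSumBoxTopology {U : ∀ i, Set (M i)} (hU : ∀ i, IsOpen (U i)) :
    @IsOpen _ (directSumBoxTopology M t) {x : ⨁ i, M i | ∀ i, x i ∈ U i} :=
  TopologicalSpace.isOpen_generateFrom_of_mem ⟨U, hU, rfl⟩

theorem directSumBoxTopology_isTopologicalAddGroup [∀ i, IsTopologicalAddGroup (M i)] :
    @IsTopologicalAddGroup (⨁ i, M i) (directSumBoxTopology M t) _ := by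
  let _ := directSumBoxTopology M t
  refine @IsTopologicalAddGroup.mk _ _ _ ⟨?_⟩ ⟨?_⟩
  · refine continuous_generateFrom_iff.2 ?_
    rintro _ ⟨U, hU, rfl⟩
    refine isOpen_iff_mem_nhds.2 fun p hp => ?_
    have h : ∀ i, ∃ A B : Set (M i), IsOpen A ∧ IsOpen B ∧ p.1 i ∈ A ∧ p.2 i ∈ B ∧
        A ×ˢ B ⊆ (fun q : M i × M i => q.1 + q.2) ⁻¹' U i := fun i =>
      isOpen_prod_iff.1 ((hU i).preimage continuous_add) (p.1 i) (p.2 i) (hp i)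
    choose A B hA hB hpA hpB hAB using h
    filter_upwards [prod_mem_nhds ((isOpen_directSumBoxTopology hA).mem_nhds hpA)
      ((isOpen_directSumBoxTopology hB).mem_nhds hpB)] with q hq i
    exact hAB i (show (q.1 i, q.2 i) ∈ A i ×ˢ B i from ⟨hq.1 i, hq.2 i⟩)
  · refine continuous_generateFrom_iff.2 ?_
    rintro _ ⟨U, hU, rfl⟩
    exact isOpen_directSumBoxTopology fun i => (hU i).preimage continuous_neg

theorem directSumBoxTopology_continuousSMul {R : Type*} [Ring R] [TopologicalSpace R]
    [WeaklyLocallyCompactSpace R] [∀ i, Module R (M i)] [∀ i, ContinuousSMul R (M i)] :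
    @ContinuousSMul R (⨁ i, M i) _ _ (directSumBoxTopology M t) := by
  classical
  let _ := directSumBoxTopology M t
  refine ⟨continuous_generateFrom_iff.2 ?_⟩
  rintro _ ⟨U, hU, rfl⟩
  refine isOpen_iff_mem_nhds.2 ?_
  rintro ⟨c, x⟩ hp
  obtain ⟨C, hC, hcC⟩ := exists_compact_mem_nhds c
  -- Infinitely many neighbourhoods of `c` cannot be intersected. At the indices with `x i = 0` the
  -- compact `C` serves for all of them, by the tube lemma around `C × {0}`; only the finitely many
  -- others need their own `N`.
  have h : ∀ i, ∃ N ∈ 𝓝 c, ∃ A : Set (M i), IsOpen A ∧ x i ∈ A ∧ (x i = 0 → N = C) ∧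
      N ×ˢ A ⊆ (fun q : R × M i => q.1 • q.2) ⁻¹' U i := by
    intro i
    have hO := (hU i).preimage (continuous_smul (M := R) (X := M i))
    by_cases hx : x i = 0
    · have h0 : (0 : M i) ∈ U i := by
        rw [← smul_zero c, ← hx]
        exact hp i
      obtain ⟨N, A, -, hA, hCN, hxA, hNA⟩ := generalized_tube_lemma hC
        (isCompact_singleton (x := x i)) hO (by rintro ⟨r, y⟩ ⟨-, rfl⟩; simpa [hx] using h0)
      exact ⟨C, hcC, A, hA, hxA rfl, fun _ => rfl, (Set.prod_mono hCN le_rfl).trans hNA⟩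
    · obtain ⟨N, A, hN, hA, hcN, hxA, hNA⟩ := isOpen_prod_iff.1 hO c (x i) (hp i)
      exact ⟨N, hN.mem_nhds hcN, A, hA, hxA, fun h => absurd h hx, hNA⟩
  choose N hN A hA hxA hNC hNA using h
  filter_upwards [prod_mem_nhds (Filter.inter_mem hcC
    ((Filter.biInter_finset_mem (DFinsupp.support x)).2 fun i _ => hN i))
    ((isOpen_directSumBoxTopology hA).mem_nhds hxA)] with q hq i
  refine hNA i (show (q.1, q.2 i) ∈ N i ×ˢ A i from ⟨?_, hq.2 i⟩)
  by_cases hx : x i = 0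
  · rw [hNC i hx]
    exact hq.1.1
  · exact Set.mem_iInter₂.1 hq.1.2 i (DFinsupp.mem_support_iff.2 hx)

theorem exists_seq_nhds_zero_sum_mem {G : Type*} [AddCommGroup G] [TopologicalSpace G]
    [ContinuousAdd G] {V : Set G} (hV : V ∈ 𝓝 (0 : G)) :
    ∃ W : ℕ → Set G, (∀ n, W n ∈ 𝓝 0) ∧
      ∀ (v : ℕ → G), (∀ n, v n ∈ W n) → ∀ n, ∑ i ∈ Finset.range n, v i ∈ V := by
  have step : ∀ A : {A : Set G // A ∈ 𝓝 0}, ∃ B : {B : Set G // B ∈ 𝓝 0},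
      ∀ v ∈ B.1, ∀ w ∈ B.1, v + w ∈ A.1 := fun A => by
    obtain ⟨B, hB, h⟩ := exists_nhds_zero_half A.2
    exact ⟨⟨B, hB⟩, h⟩
  choose f hf using step
  let W : ℕ → {A : Set G // A ∈ 𝓝 0} := fun n => Nat.rec ⟨V, hV⟩ (fun _ => f) n
  refine ⟨fun n => (W (n + 1)).1, fun n => (W (n + 1)).2, fun v hv n => ?_⟩
  -- Each `W (n + 1)` satisfies `W (n + 1) + W (n + 1) ⊆ W n`; the extra summand `w ∈ W n` is the
  -- room left for the later terms.
  have key : ∀ n, ∀ w ∈ (W n).1, ∑ i ∈ Finset.range n, v i + w ∈ V := by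
    intro n
    induction n with
    | zero => exact fun w hw => by simpa using (show w ∈ V from hw)
    | succ n ih =>
      intro w hw
      rw [Finset.sum_range_succ, add_assoc]
      exact ih _ (hf (W n) _ (hv n) _ hw)
  simpa using key n 0 (mem_of_mem_nhds (W n).2)

/-- An additive map on a countable direct sum with the box topology is continuous if it is
continuous on each summand. -/
theorem continuous_directSumBoxTopology {M : ℕ → Type*} [∀ i, AddCommGroup (M i)]
    [t : ∀ i, TopologicalSpace (M i)] [∀ i, IsTopologicalAddGroup (M i)] {G : Type*}
    [AddCommGroup G] [TopologicalSpace G] [IsTopologicalAddGroup G] (f : (⨁ i, M i) →+ G)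
    (hf : ∀ i, Continuous fun x : M i => f (DirectSum.of M i x)) :
    Continuous[directSumBoxTopology M t, inferInstance] f := by
  classical
  let _ := directSumBoxTopology M t
  have := directSumBoxTopology_isTopologicalAddGroup (M := M)
  refine continuous_of_continuousAt_zero f ?_
  rw [ContinuousAt, map_zero]
  intro V hV
  -- Countability of the index set enters here: one sequence of neighbourhoods controls finite sums
  -- of every length.
  obtain ⟨W, hW, hWV⟩ := exists_seq_nhds_zero_sum_mem hV
  refine Filter.mem_map.2 (Filter.mem_of_superset ((directSumBoxTopology_hasBasis_nhds_zero M t).mem_of_mem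
    (i := fun i => (fun x : M i => f (DirectSum.of M i x)) ⁻¹' W i)
    fun i => (hf i).continuousAt.preimage_mem_nhds (by simpa using hW i)) fun x hx => ?_)
  obtain ⟨n, hn⟩ := (DFinsupp.support x).exists_nat_subset_range
  have hx' : ∑ i ∈ Finset.range n, DirectSum.of M i (x i) = x := by
    refine (Finset.sum_subset hn fun i _ hi => ?_).symm.trans (DirectSum.sum_support_of x)
    rw [DFinsupp.notMem_support_iff.1 hi, map_zero]
  have h := hWV (fun i => f (DirectSum.of M i (x i))) hx n
  rwa [← map_sum, hx'] at h

end Box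

/-! ### The tensor algebra as an open quotient of a free vector space -/

/-- A continuous linear surjection is open if the inverse of the induced bijection from the
quotient by the kernel is continuous. -/
theorem LinearMap.isOpenQuotientMap_of_continuous_section {R F W : Type*} [Ring R]
    [AddCommGroup F] [Module R F] [TopologicalSpace F] [ContinuousAdd F] [AddCommGroup W]
    [Module R W] [TopologicalSpace W] (q : F →ₗ[R] W) (hs : Function.Surjective q)
    (hc : Continuous q)
    (h : ∀ s : W →ₗ[R] F ⧸ q.ker, (∀ v, s (q v) = q.ker.mkQ v) → Continuous s) :
    IsOpenQuotientMap q := by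
  let e := q.quotKerEquivOfSurjective hs
  have he : ∀ v, e.symm (q v) = q.ker.mkQ v := fun v => by
    rw [LinearEquiv.symm_apply_eq]; rfl
  have hec : Continuous e.symm := h e.symm.toLinearMap he
  refine ⟨hs, hc, fun U hU => ?_⟩
  -- The image `q '' U` is the preimage under `e.symm` of the image of `U` in the quotient, which is
  -- open.
  convert (q.ker.isOpenMap_mkQ U hU).preimage hec
  ext y
  constructor
  · rintro ⟨v, hv, rfl⟩
    exact ⟨v, hv, (he v).symm⟩
  · rintro ⟨v, hv, h⟩
    exact ⟨v, hv, e.symm.injective ((he v).trans h)⟩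

namespace TNu

variable (𝕜 : Type*) [RCLike 𝕜] (E : Type*) [AddCommGroup E] [Module 𝕜 E]

variable {E}

/-- The product `x₁ ⊗ ⋯ ⊗ xⱼ` of a finite sequence of vectors. -/
noncomputable def word (p : Σ j : ℕ, Fin j → E) : TNu 𝕜 E :=
  DirectSum.of (fun j : ℕ => ⨂[𝕜]^j E) p.1 (PiTensorProduct.tprod 𝕜 p.2)

theorem word_mul_word {m n : ℕ} (x : Fin m → E) (y : Fin n → E) :
    word 𝕜 ⟨m, x⟩ * word 𝕜 ⟨n, y⟩ = word 𝕜 ⟨m + n, Fin.append x y⟩ := by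
  refine (DirectSum.of_mul_of (A := fun j : ℕ => ⨂[𝕜]^j E) _ _).trans ?_
  exact congrArg _ (TensorPower.tprod_mul_tprod 𝕜 x y)

theorem exists_lift_word_eq (y : TNu 𝕜 E) : ∃ v, FreeTVS.lift 𝕜 (word 𝕜 (E := E)) v = y := by
  have hadd : ∀ y z : TNu 𝕜 E, (∃ v, FreeTVS.lift 𝕜 (word 𝕜) v = y) →
      (∃ v, FreeTVS.lift 𝕜 (word 𝕜) v = z) → ∃ v, FreeTVS.lift 𝕜 (word 𝕜) v = y + z := by
    rintro _ _ ⟨v, rfl⟩ ⟨w, rfl⟩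
    exact ⟨v + w, map_add _ v w⟩
  refine DirectSum.induction_on (motive := fun y => ∃ v, FreeTVS.lift 𝕜 (word 𝕜) v = y) y
    ⟨0, map_zero _⟩ (fun j t => ?_) hadd
  induction t using PiTensorProduct.induction_on with
  | smul_tprod c x =>
    refine ⟨c • FreeTVS.of 𝕜 ⟨j, x⟩, ?_⟩
    rw [map_smul, FreeTVS.lift_of]
    exact ((DirectSum.lof 𝕜 ℕ (fun j : ℕ => ⨂[𝕜]^j E) j).map_smul c _).symm
  | add t u ht hu =>
    rw [map_add]
    exact hadd _ _ ht hu

variable (E) in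
/-- The tensor algebra as a direct sum of tensor powers. -/
noncomputable def equivTensorAlgebra : TensorAlgebra 𝕜 E ≃ₐ[𝕜] TNu 𝕜 E :=
  TensorAlgebra.equivDirectSum

theorem equivTensorAlgebra_ι (x : E) :
    equivTensorAlgebra 𝕜 E (TensorAlgebra.ι 𝕜 x) = TNu.ι 𝕜 E x :=
  TensorAlgebra.lift_ι_apply _ x

theorem equivTensorAlgebra_symm_word {j : ℕ} (x : Fin j → E) :
    (equivTensorAlgebra 𝕜 E).symm (word 𝕜 ⟨j, x⟩) = TensorAlgebra.tprod 𝕜 E j x :=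
  TensorAlgebra.ofDirectSum_of_tprod x

variable [TopologicalSpace E]

variable (E) in
instance isTopologicalAddGroup : IsTopologicalAddGroup (TNu 𝕜 E) :=
  have := fun j : ℕ => (nuTopology_mem 𝕜 fun _ : Fin j => E).1
  directSumBoxTopology_isTopologicalAddGroup (t := nuPowerTopology 𝕜 E)

variable (E) in
instance continuousAdd : ContinuousAdd (TNu 𝕜 E) := (isTopologicalAddGroup 𝕜 E).toContinuousAdd

variable (E) in
instance continuousSMul : ContinuousSMul 𝕜 (TNu 𝕜 E) :=
  have := fun j : ℕ => (nuTopology_mem 𝕜 fun _ : Fin j => E).2.1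
  directSumBoxTopology_continuousSMul (t := nuPowerTopology 𝕜 E)

theorem continuous_word : Continuous (word 𝕜 (E := E)) :=
  continuous_sigma fun j =>
    let _ := nuPowerTopology 𝕜 E
    let _ := directSumBoxTopology (fun j : ℕ => ⨂[𝕜]^j E) (nuPowerTopology 𝕜 E)
    (directSumBoxTopology_isEmbedding_of (fun j : ℕ => ⨂[𝕜]^j E) (nuPowerTopology 𝕜 E)
      j).continuous.comp (nuTopology_mem 𝕜 fun _ : Fin j => E).2.2

/-- The box topology reduces the claim to each summand. There the topology induced from `W` is a
vector topology making the universal multilinear map continuous, hence coarser than the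
`ν`-topology. -/
theorem continuous_linearMap {W : Type*} [AddCommGroup W] [Module 𝕜 W] [TopologicalSpace W]
    [IsTopologicalAddGroup W] [ContinuousSMul 𝕜 W] (f : TNu 𝕜 E →ₗ[𝕜] W)
    (hf : ∀ j, Continuous fun x : Fin j → E => f (word 𝕜 ⟨j, x⟩)) : Continuous f := by
  have := fun j : ℕ => (nuTopology_mem 𝕜 fun _ : Fin j => E).1
  let _ := nuPowerTopology 𝕜 E
  refine continuous_directSumBoxTopology (M := fun j : ℕ => ⨂[𝕜]^j E) f.toAddMonoidHom fun j => ?_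
  let g : (⨂[𝕜]^j E) →ₗ[𝕜] W := f.comp (DirectSum.lof 𝕜 ℕ (fun j : ℕ => ⨂[𝕜]^j E) j)
  refine continuous_iff_le_induced.2 (sInf_le (a := TopologicalSpace.induced g inferInstance)
    ⟨topologicalAddGroup_induced g, continuousSMul_induced g, continuous_induced_rng.2 (hf j)⟩)

/-- The quotient of the free space by the kernel is a topological vector space in which the class of
a word depends continuously on the word. Thus the inverse bijection from `TNu 𝕜 E` is continuous by
`continuous_linearMap`. -/
theorem isOpenQuotientMap_lift_word [IsTopologicalAddGroup E] (hE : IsKOmegaSpace E) :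
    IsOpenQuotientMap (FreeTVS.lift 𝕜 (word 𝕜 (E := E))) := by
  have := IsTopologicalAddGroup.completelyRegularSpace E
  have hX : IsKOmegaSpace (Σ j : ℕ, Fin j → E) := .sigma fun n => hE.finPi n
  have := FreeTVS.isTopologicalAddGroup 𝕜 hX
  have := FreeTVS.continuousSMul 𝕜 hX
  have hc : Continuous (FreeTVS.lift 𝕜 (word 𝕜 (E := E))) :=
    FreeTVS.continuous_linearMap 𝕜 _ (by simpa only [FreeTVS.lift_of] using continuous_word 𝕜)
  let _ : TopologicalSpace (⨁ j : ℕ, ⨂[𝕜]^j E) := TNu.instTopologicalSpace 𝕜 E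
  refine LinearMap.isOpenQuotientMap_of_continuous_section (W := ⨁ j : ℕ, ⨂[𝕜]^j E)
    (FreeTVS.lift 𝕜 (word 𝕜)) (exists_lift_word_eq 𝕜) hc fun s hs =>
    continuous_linearMap 𝕜 s fun j => ?_
  have h : ∀ x : Fin j → E, s (word 𝕜 ⟨j, x⟩) = Submodule.mkQ _ (FreeTVS.of 𝕜 ⟨j, x⟩) := fun x =>
    (congrArg s (FreeTVS.lift_of 𝕜 (word 𝕜) ⟨j, x⟩)).symm.trans (hs _)
  refine (continuous_congr h).2 ?_
  exact continuous_quot_mk.comp ((FreeTVS.continuous_of 𝕜).comp continuous_sigmaMk)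

theorem continuousMul [IsTopologicalAddGroup E] (hE : IsKOmegaSpace E) :
    ContinuousMul (TNu 𝕜 E) := by
  have := IsTopologicalAddGroup.completelyRegularSpace E
  have hX : IsKOmegaSpace (Σ j : ℕ, Fin j → E) := .sigma fun n => hE.finPi n
  have hq := isOpenQuotientMap_lift_word 𝕜 hE
  -- Using openness here, rather than the `k_ω` product theorem, avoids having to know that `TNu 𝕜
  -- E` is Hausdorff.
  refine ⟨(hq.prodMap hq).continuous_comp_iff.1 ?_⟩
  refine FreeTVS.continuous_bilinear 𝕜 hX hX (LinearMap.mk₂ 𝕜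
    (fun u v => FreeTVS.lift 𝕜 (word 𝕜 (E := E)) u * FreeTVS.lift 𝕜 (word 𝕜) v)
    (fun _ _ _ => by rw [map_add, add_mul]) (fun _ _ _ => by rw [map_smul, smul_mul_assoc])
    (fun _ _ _ => by rw [map_add, mul_add]) (fun _ _ _ => by rw [map_smul, mul_smul_comm])) ?_
  refine continuous_sigma_prod fun m n => ?_
  simp only [LinearMap.mk₂_apply, FreeTVS.lift_of, word_mul_word]
  exact (continuous_word 𝕜).comp
    (continuous_sigmaMk.comp (Fin.appendHomeomorph m n).continuous)

end TNu

/-! ### The topological algebra and its universal property -/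

theorem mainTheorem6 {𝕜 : Type*} [RCLike 𝕜] {E : Type*} [AddCommGroup E] [Module 𝕜 E]
    [TopologicalSpace E] [IsTopologicalAddGroup E] [ContinuousSMul 𝕜 E] (hE : IsKOmegaSpace E) :
    (IsTopologicalRing (TNu 𝕜 E) ∧ ContinuousSMul 𝕜 (TNu 𝕜 E)) ∧
      ∀ (A : Type*) [Ring A] [Algebra 𝕜 A] [TopologicalSpace A] [IsTopologicalRing A]
        [ContinuousSMul 𝕜 A] (φ : E →L[𝕜] A),
        ∃! Φ : TNu 𝕜 E →A[𝕜] A, ∀ x : E, Φ (TNu.ι 𝕜 E x) = φ x := by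
  have := TNu.continuousMul 𝕜 hE
  refine ⟨⟨{ }, inferInstance⟩, ?_⟩
  intro A _ _ _ _ _ φ
  let e := TNu.equivTensorAlgebra 𝕜 E
  let Φ : TNu 𝕜 E →ₐ[𝕜] A := (TensorAlgebra.lift 𝕜 φ.toLinearMap).comp e.symm.toAlgHom
  have hΦ : Continuous Φ := by
    refine TNu.continuous_linearMap 𝕜 Φ.toLinearMap fun j => ?_
    -- On words `Φ` is a finite product of values of `φ`, so it is continuous there because `A` is a
    -- topological ring.
    have h : ∀ x : Fin j → E, Φ (TNu.word 𝕜 ⟨j, x⟩) =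
        ((List.finRange j).map fun i => φ (x i)).prod := fun x => by
      change TensorAlgebra.lift 𝕜 φ.toLinearMap (e.symm (TNu.word 𝕜 ⟨j, x⟩)) = _
      rw [TNu.equivTensorAlgebra_symm_word, TensorAlgebra.tprod_apply, map_list_prod,
        List.map_ofFn, List.ofFn_eq_map]
      simp [Function.comp_def]
    simp only [AlgHom.toLinearMap_apply, h]
    exact continuous_list_prod _ fun i _ => by fun_prop
  refine ⟨⟨Φ, hΦ⟩, fun x => ?_, fun Ψ hΨ => ?_⟩
  · change TensorAlgebra.lift 𝕜 φ.toLinearMap (e.symm (TNu.ι 𝕜 E x)) = φ x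
    rw [← TNu.equivTensorAlgebra_ι, AlgEquiv.symm_apply_apply, TensorAlgebra.lift_ι_apply]
    rfl
  · have h : (Ψ : TNu 𝕜 E →ₐ[𝕜] A).comp e.toAlgHom = TensorAlgebra.lift 𝕜 φ.toLinearMap := by
      refine TensorAlgebra.hom_ext (LinearMap.ext fun x => ?_)
      change Ψ (e (TensorAlgebra.ι 𝕜 x)) = TensorAlgebra.lift 𝕜 _ (TensorAlgebra.ι 𝕜 x)
      rw [TNu.equivTensorAlgebra_ι, hΨ, TensorAlgebra.lift_ι_apply]
      rfl
    ext y
    obtain ⟨z, rfl⟩ := e.surjective y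
    change Ψ (e z) = TensorAlgebra.lift 𝕜 φ.toLinearMap (e.symm (e z))
    rw [AlgEquiv.symm_apply_apply]
    exact DFunLike.congr_fun h z
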